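/- Let $r\ge 0$ and let $W_r$ be the hyperoctahedral group, i.e. the group of permutations $\sigma$ of $\{-r,\dots,-1,1,\dots,r\}$ with $\sigma(-x)=-\sigma(x)$. For $\sigma\in W_r$ let $|\sigma|\in\mathfrak S_r$ be the induced permutation of absolute values and put $\operatorname{sgn}\sigma=(-1)^{\#\{i>0\,:\,\sigma(i)<0\}}\operatorname{sgn}|\sigma|$. Let $K$ be any field (of arbitrary characteristic, $0$ and $2$ included). A bi-partition of $r$ is a pair $\lambda=(\lambda^1,\lambda^2)$ of (possibly empty) partitions with $|\lambda^1|+|\lambda^2|=r$; its conjugate is $\lambda'=((\lambda^{2})',(\lambda^{1})')$. A $\lambda$-bi-tableau $\mathfrak t=(\mathfrak t^1,\mathfrak t^2)$ is a filling of the boxes of the Young diagrams of $\lambda^1$ and $\lambda^2$ by elements of $\{\pm1,\dots,\pm r\}$ such that each of $1,\dots,r$ occurs exactly once up to sign. $W_r$ acts on bi-tableaux through the entries. Let $R_{\mathfrak t}\le W_r$ be the group of elements permuting the entries within each row of $\mathfrak t$ and possibly changing signs of entries of $\mathfrak t^2$, and $C_{\mathfrak t}\le W_r$ the group of elements permuting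 the entries within each column of $\mathfrak t$ and possibly changing signs of entries of $\mathfrak t^1$. The bi-tabloid $\{\mathfrak t\}$ is the class of $\mathfrak t$ modulo $R_{\mathfrak t}$, and $M(\lambda)$ is the $K$-vector space with basis the $\lambda$-bi-tabloids, on which $W_r$ acts by $\sigma\{\mathfrak t\}=\{\sigma\mathfrak t\}$. The Specht module $S(\lambda)\subseteq M(\lambda)$ is the span of all polytabloids $e_{\mathfrak t}=\sum_{\sigma\in C_{\mathfrak t}}\operatorname{sgn}(\sigma)\,\sigma\{\mathfrak t\}$. The dual Specht module $S'(\lambda)$ is $\operatorname{Hom}_K(S(\lambda),K)$ with $(\sigma\varphi)(m)=\varphi(\sigma^{-1}m)$. The sign module is $\operatorname{sgn}:=S\big((1^r),\emptyset\big)$. Then for every bi-partition $\lambda$ of $r$ there is an isomorphism of $KW_r$-modules $$S'(\lambda')\;\cong\; S(\lambda)\otimes_K S\big((1^r),\emptyset\big)=S(\lambda)\otimes_K\operatorname{sgn},$$ where $W_r$ acts diagonally on the tensor product. -/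

import Mathlib

open scoped Pointwise

namespace Hyperoctahedral

/-! ### The hyperoctahedral group -/

/-- The set `{-r, …, -1, 1, …, r}`: the pair `(i, ε)` with `i : Fin r` and `ε = ±1` stands for
the integer `ε * (i + 1)`. -/
abbrev Pt (r : ℕ) : Type := Fin r × ℤˣ

/-- The map `x ↦ -x` of `{-r, …, -1, 1, …, r}`. -/
def negPt {r : ℕ} (x : Pt r) : Pt r := (x.1, -x.2)

/-- The hyperoctahedral group `W_r`: all permutations `σ` of `{-r, …, -1, 1, …, r}` such that
`σ (-x) = - σ x`. -/
def W (r : ℕ) : Subgroup (Equiv.Perm (Pt r)) where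
  carrier := {σ | ∀ x, σ (negPt x) = negPt (σ x)}
  mul_mem' := by
    intro a b ha hb x
    rw [Equiv.Perm.mul_apply, hb x, ha, Equiv.Perm.mul_apply]
  one_mem' := fun _ => rfl
  inv_mem' := by
    intro a ha x
    rw [Equiv.Perm.inv_eq_iff_eq, ha, ← Equiv.Perm.mul_apply, mul_inv_cancel,
      Equiv.Perm.one_apply]

theorem negPt_negPt {r : ℕ} (x : Pt r) : negPt (negPt x) = x := by simp [negPt]

theorem W.smul_negPt {r : ℕ} (σ : W r) (x : Pt r) : σ • negPt x = negPt (σ • x) := σ.2 x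

theorem W.smul_eq {r : ℕ} (σ : W r) (x : Pt r) :
    σ • x = ((σ • ((x.1, 1) : Pt r)).1, x.2 * (σ • ((x.1, 1) : Pt r)).2) := by
  obtain ⟨i, ε⟩ := x
  rcases Int.units_eq_one_or ε with rfl | rfl
  · simp
  · have h := W.smul_negPt σ ((i, 1) : Pt r)
    rw [show negPt ((i, 1) : Pt r) = (i, -1) from rfl] at h
    rw [h]
    simp [negPt]

theorem W.smul_fst {r : ℕ} (σ : W r) (x : Pt r) :
    (σ • x).1 = (σ • ((x.1, 1) : Pt r)).1 := by
  rw [W.smul_eq]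

/-- The permutation `|σ|` of the absolute values `{1, …, r}` induced by `σ`. -/
def W.abs {r : ℕ} : W r →* Equiv.Perm (Fin r) :=
  MonoidHom.toHomPerm
    { toFun := fun σ i => (σ • ((i, 1) : Pt r)).1
      map_one' := by funext i; simp only [one_smul]; rfl
      map_mul' := by
        intro σ τ
        funext i
        change ((σ * τ) • ((i, 1) : Pt r)).1 = (σ • (((τ • ((i, 1) : Pt r)).1, 1) : Pt r)).1
        rw [mul_smul, W.smul_fst] }

theorem W.abs_apply {r : ℕ} (σ : W r) (i : Fin r) : W.abs σ i = (σ • ((i, 1) : Pt r)).1 := rfl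

/-- The sign of `σ = (∏ ξ_i) |σ|`: the sign of the permutation `|σ|` times `-1` for each sign
change `ξ_i`, that is, for each `i > 0` with `σ i < 0`. -/
def W.sgn {r : ℕ} : W r →* ℤˣ where
  toFun σ := (∏ i : Fin r, (σ • ((i, 1) : Pt r)).2) * Equiv.Perm.sign (W.abs σ)
  map_one' := by simp
  map_mul' := by
    intro σ τ
    have h : ∀ i : Fin r, ((σ * τ) • ((i, 1) : Pt r)).2
        = (τ • ((i, 1) : Pt r)).2 * (σ • ((W.abs τ i, 1) : Pt r)).2 := by
      intro i
      rw [mul_smul, W.smul_eq σ (τ • ((i, 1) : Pt r)), W.abs_apply]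
    simp only [h, Finset.prod_mul_distrib, map_mul]
    rw [Equiv.prod_comp (W.abs τ) (fun j => (σ • ((j, 1) : Pt r)).2)]
    ac_rfl

/-! ### Bi-partitions -/

/-- A bi-partition `(λ¹, λ²)` of `r`: partitions are given by their Young diagrams, in which a
box `(i, j)` lies in row `i` and column `j`. -/
@[ext]
structure BiPartition (r : ℕ) where
  /-- The first component `λ¹`. -/
  fst : YoungDiagram
  /-- The second component `λ²`. -/
  snd : YoungDiagram
  card_add_card : fst.card + snd.card = r

theorem card_transpose (μ : YoungDiagram) : μ.transpose.card = μ.card := by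
  simp [YoungDiagram.card, YoungDiagram.transpose]

/-- The conjugate bi-partition `λ' = (λ²', λ¹')`. -/
def BiPartition.conj {r : ℕ} (l : BiPartition r) : BiPartition r where
  fst := l.snd.transpose
  snd := l.fst.transpose
  card_add_card := by rw [card_transpose, card_transpose, add_comm, l.card_add_card]

/-- The partition `(1^r)`: one column with `r` boxes. -/
def oneColumn (r : ℕ) : YoungDiagram where
  cells := Finset.range r ×ˢ {0}
  isLowerSet := by
    rintro ⟨a, b⟩ ⟨c, d⟩ ⟨h1, h2⟩ h
    simp only [Finset.coe_product, Set.mem_prod, Finset.mem_coe, Finset.mem_range,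
      Finset.mem_singleton] at h ⊢
    simp only at h1 h2
    omega

/-- The bi-partition `((1^r), ∅)`. -/
def signShape (r : ℕ) : BiPartition r where
  fst := oneColumn r
  snd := ⊥
  card_add_card := by simp [YoungDiagram.card, oneColumn]

/-- The boxes of the pair of Young diagrams `(λ¹, λ²)`. -/
abbrev BiPartition.Box {r : ℕ} (l : BiPartition r) : Type :=
  {c : ℕ × ℕ // c ∈ l.fst} ⊕ {c : ℕ × ℕ // c ∈ l.snd}

/-! ### Bi-tableaux -/

/-- A bi-tableau of shape `l`: the boxes are filled with elements of `{-r, …, -1, 1, …, r}` in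
such a way that, up to sign, each of `1, …, r` occurs exactly once. -/
@[ext]
structure BiTableau {r : ℕ} (l : BiPartition r) where
  /-- The entry of a box. -/
  entry : l.Box → Pt r
  bijective : Function.Bijective fun b => (entry b).1

namespace BiTableau

variable {r : ℕ} {l : BiPartition r}

/-- `W_r` acts on bi-tableaux through their entries. -/
instance : MulAction (W r) (BiTableau l) where
  smul σ t :=
    { entry := fun b => σ • t.entry b
      bijective := by
        have h : (fun b => (σ • t.entry b).1) = W.abs σ ∘ fun b => (t.entry b).1 := by
          funext b
          exact W.smul_fst σ (t.entry b)
        rw [h]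
        exact (W.abs σ).bijective.comp t.bijective }
  one_smul t := by
    ext1
    funext b
    exact one_smul _ _
  mul_smul σ τ t := by
    ext1
    funext b
    exact mul_smul _ _ _

theorem smul_entry (σ : W r) (t : BiTableau l) (b : l.Box) :
    (σ • t).entry b = σ • t.entry b := rfl

/-- The entries of `t` in row `i` of the first tableau. -/
def row₁ (t : BiTableau l) (i : ℕ) : Set (Pt r) :=
  {x | ∃ c, c.1.1 = i ∧ x = t.entry (.inl c)}

/-- The entries of `t` in row `i` of the second tableau, together with their negatives. -/
def row₂ (t : BiTableau l) (i : ℕ) : Set (Pt r) :=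
  {x | ∃ c, c.1.1 = i ∧ (x = t.entry (.inr c) ∨ x = negPt (t.entry (.inr c)))}

/-- The entries of `t` in column `j` of the first tableau, together with their negatives. -/
def col₁ (t : BiTableau l) (j : ℕ) : Set (Pt r) :=
  {x | ∃ c, c.1.2 = j ∧ (x = t.entry (.inl c) ∨ x = negPt (t.entry (.inl c)))}

/-- The entries of `t` in column `j` of the second tableau. -/
def col₂ (t : BiTableau l) (j : ℕ) : Set (Pt r) :=
  {x | ∃ c, c.1.2 = j ∧ x = t.entry (.inr c)}

/-- The group `R_t` of row permutations: the elements of `W_r` that permute the entries within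
each row of `t`, and may change the sign of the entries of the second tableau. -/
def rowGroup (t : BiTableau l) : Subgroup (W r) :=
  (⨅ i, MulAction.stabilizer (W r) (t.row₁ i)) ⊓ (⨅ i, MulAction.stabilizer (W r) (t.row₂ i))

/-- The group `C_t` of column permutations: the elements of `W_r` that permute the entries within
each column of `t`, and may change the sign of the entries of the first tableau. -/
def colGroup (t : BiTableau l) : Subgroup (W r) :=
  (⨅ j, MulAction.stabilizer (W r) (t.col₁ j)) ⊓ (⨅ j, MulAction.stabilizer (W r) (t.col₂ j))

theorem mem_rowGroup {t : BiTableau l} {σ : W r} :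
    σ ∈ t.rowGroup ↔ (∀ i, σ • t.row₁ i = t.row₁ i) ∧ ∀ i, σ • t.row₂ i = t.row₂ i := by
  simp only [rowGroup, Subgroup.mem_inf, Subgroup.mem_iInf, MulAction.mem_stabilizer_iff]

theorem mem_colGroup {t : BiTableau l} {σ : W r} :
    σ ∈ t.colGroup ↔ (∀ j, σ • t.col₁ j = t.col₁ j) ∧ ∀ j, σ • t.col₂ j = t.col₂ j := by
  simp only [colGroup, Subgroup.mem_inf, Subgroup.mem_iInf, MulAction.mem_stabilizer_iff]

theorem row₁_smul (σ : W r) (t : BiTableau l) (i : ℕ) : (σ • t).row₁ i = σ • t.row₁ i := by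
  ext x
  simp only [row₁, Set.mem_smul_set_iff_inv_smul_mem, Set.mem_ofPred_eq, smul_entry,
    inv_smul_eq_iff]

theorem row₂_smul (σ : W r) (t : BiTableau l) (i : ℕ) : (σ • t).row₂ i = σ • t.row₂ i := by
  ext x
  simp only [row₂, Set.mem_smul_set_iff_inv_smul_mem, Set.mem_ofPred_eq, smul_entry,
    inv_smul_eq_iff, W.smul_negPt]

theorem col₁_smul (σ : W r) (t : BiTableau l) (j : ℕ) : (σ • t).col₁ j = σ • t.col₁ j := by
  ext x
  simp only [col₁, Set.mem_smul_set_iff_inv_smul_mem, Set.mem_ofPred_eq, smul_entry,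
    inv_smul_eq_iff, W.smul_negPt]

theorem col₂_smul (σ : W r) (t : BiTableau l) (j : ℕ) : (σ • t).col₂ j = σ • t.col₂ j := by
  ext x
  simp only [col₂, Set.mem_smul_set_iff_inv_smul_mem, Set.mem_ofPred_eq, smul_entry,
    inv_smul_eq_iff]

theorem mem_rowGroup_smul {t : BiTableau l} {σ τ : W r} :
    τ ∈ (σ • t).rowGroup ↔ σ⁻¹ * τ * σ ∈ t.rowGroup := by
  simp only [mem_rowGroup, row₁_smul, row₂_smul, mul_smul, inv_smul_eq_iff]

theorem mem_colGroup_smul {t : BiTableau l} {σ τ : W r} :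
    τ ∈ (σ • t).colGroup ↔ σ⁻¹ * τ * σ ∈ t.colGroup := by
  simp only [mem_colGroup, col₁_smul, col₂_smul, mul_smul, inv_smul_eq_iff]

/-- Two bi-tableaux are equivalent if they differ by a row permutation. -/
instance rowSetoid (l : BiPartition r) : Setoid (BiTableau l) where
  r t₁ t₂ := ∃ σ ∈ t₁.rowGroup, t₂ = σ • t₁
  iseqv :=
    { refl := fun t => ⟨1, one_mem _, (one_smul _ _).symm⟩
      symm := by
        rintro t₁ _ ⟨σ, hσ, rfl⟩
        refine ⟨σ⁻¹, ?_, (inv_smul_smul _ _).symm⟩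
        rw [mem_rowGroup_smul]
        simpa using hσ
      trans := by
        rintro t₁ _ _ ⟨σ, hσ, rfl⟩ ⟨τ, hτ, rfl⟩
        refine ⟨τ * σ, ?_, (mul_smul _ _ _).symm⟩
        rw [mem_rowGroup_smul] at hτ
        simpa [mul_assoc] using mul_mem hσ hτ }

theorem equiv_iff {t₁ t₂ : BiTableau l} : t₁ ≈ t₂ ↔ ∃ σ ∈ t₁.rowGroup, t₂ = σ • t₁ := Iff.rfl

theorem smul_equiv_smul (σ : W r) {t₁ t₂ : BiTableau l} (h : t₁ ≈ t₂) : σ • t₁ ≈ σ • t₂ := by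
  obtain ⟨τ, hτ, rfl⟩ := h
  refine ⟨σ * τ * σ⁻¹, ?_, ?_⟩
  · rw [mem_rowGroup_smul]
    simpa [mul_assoc] using hτ
  · simp [mul_smul]

end BiTableau

/-! ### Permutation modules and Specht modules -/

/-- The bi-tabloids of shape `l`: row equivalence classes `{t}` of bi-tableaux. -/
abbrev BiTabloid {r : ℕ} (l : BiPartition r) : Type := Quotient (BiTableau.rowSetoid l)

/-- The action `σ {t} = {σ t}` on bi-tabloids. -/
instance {r : ℕ} (l : BiPartition r) : MulAction (W r) (BiTabloid l) where
  smul σ := Quotient.map (σ • ·) fun _ _ h => BiTableau.smul_equiv_smul σ h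
  one_smul := by
    rintro ⟨t⟩
    exact congrArg (Quotient.mk _) (one_smul _ t)
  mul_smul σ τ := by
    rintro ⟨t⟩
    exact congrArg (Quotient.mk _) (mul_smul σ τ t)

section

variable (K : Type*) [Field K] {r : ℕ} {l : BiPartition r}

/-- The permutation module `M(l)`: the `K`-vector space with the bi-tabloids as basis, on which
`W_r` acts by permuting the basis. -/
noncomputable def permModule (l : BiPartition r) :
    Representation K (W r) (MonoidAlgebra K (BiTabloid l)) :=
  Representation.ofMulAction K (W r) (BiTabloid l)

/-- The bi-tabloid `{t}` as an element of `M(l)`. -/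
noncomputable def tabloid (t : BiTableau l) : MonoidAlgebra K (BiTabloid l) :=
  MonoidAlgebra.single (Quotient.mk _ t) 1

open scoped Classical in
/-- The alternating column sum `k_t = ∑_{σ ∈ C_t} sgn(σ) σ` in the group algebra. -/
noncomputable def columnSum (t : BiTableau l) : MonoidAlgebra K (W r) :=
  ∑ σ : t.colGroup, MonoidAlgebra.single (σ : W r) (((W.sgn (σ : W r) : ℤˣ) : ℤ) : K)

/-- The polytabloid `e_t`, obtained by applying `k_t` to `{t}`. -/
noncomputable def polytabloid (t : BiTableau l) : MonoidAlgebra K (BiTabloid l) :=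
  (permModule K l).asAlgebraHom (columnSum K t) (tabloid K t)

theorem permModule_tabloid (σ : W r) (t : BiTableau l) :
    permModule K l σ (tabloid K t) = tabloid K (σ • t) := by
  simp only [permModule, tabloid, Representation.ofMulAction_single]
  rfl

open scoped Classical in
theorem polytabloid_eq (t : BiTableau l) :
    polytabloid K t = ∑ σ : t.colGroup,
      (((W.sgn (σ : W r) : ℤˣ) : ℤ) : K) • tabloid K ((σ : W r) • t) := by
  simp [polytabloid, columnSum, permModule_tabloid]

theorem permModule_polytabloid (σ : W r) (t : BiTableau l) :
    permModule K l σ (polytabloid K t) = polytabloid K (σ • t) := by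
  classical
  simp only [polytabloid_eq, map_sum, map_smul, permModule_tabloid]
  refine Finset.sum_bij'
    (fun τ _ => ⟨σ * (τ : W r) * σ⁻¹, by
      rw [BiTableau.mem_colGroup_smul]; simp [mul_assoc]⟩)
    (fun τ _ => ⟨σ⁻¹ * (τ : W r) * σ, BiTableau.mem_colGroup_smul.1 τ.2⟩) ?_ ?_ ?_ ?_ ?_
  · simp
  · simp
  · intro τ _
    ext1
    simp [mul_assoc]
  · intro τ _
    ext1
    simp [mul_assoc]
  · intro τ _
    have h : W.sgn (σ * (τ : W r) * σ⁻¹) = W.sgn (τ : W r) := by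
      rw [map_mul, map_mul, map_inv, mul_comm (W.sgn σ), mul_inv_cancel_right]
    simp only [h, mul_smul, inv_smul_smul]

/-- The Specht module `S(l)` as a submodule of `M(l)`: the span of all polytabloids. -/
noncomputable def spechtSub (l : BiPartition r) : Subrepresentation (permModule K l) where
  toSubmodule := Submodule.span K (Set.range (polytabloid K (l := l)))
  apply_mem_toSubmodule := by
    intro σ v hv
    induction hv using Submodule.span_induction with
    | mem x hx =>
      obtain ⟨t, rfl⟩ := hx
      rw [permModule_polytabloid]
      exact Submodule.subset_span ⟨_, rfl⟩
    | zero => rw [map_zero]; exact zero_mem _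
    | add x y _ _ hx hy => rw [map_add]; exact add_mem hx hy
    | smul a x _ hx => rw [map_smul]; exact Submodule.smul_mem _ _ hx

/-- The Specht module `S(l)`. -/
noncomputable def specht (l : BiPartition r) :
    Representation K (W r) (spechtSub K l).toSubmodule :=
  (spechtSub K l).toRepresentation

/-- The dual Specht module `S'(l)`, with `(σ φ)(m) = φ (σ⁻¹ m)`. -/
noncomputable def dualSpecht (l : BiPartition r) :
    Representation K (W r) (Module.Dual K (spechtSub K l).toSubmodule) :=
  (specht K l).dual

end

end Hyperoctahedral

/-! Both modules are spanned by families indexed by the `λ`-bi-tableaux `t` and permuted by `W_r`: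
on the dual side the coordinate forms at `{t'}`, restricted to `S(λ')`; on the other side `ε(t) e_t
⊗ e_u`, where `ε(σt) = sgn(σ) ε(t)` and `e_u` spans the sign module. Two such families with the same
linear relations give isomorphic modules, so only relations need comparing.

A form on `S(λ')` vanishes iff it kills every `e_{s'}`, and a vector of `M(λ)` vanishes iff all its
coordinates at `{s}` do. Both sets of relations are thus kernels of square matrices, and
`tabloidCoord_conj_polytabloid` shows that the coefficient of `{t'}` in `e_{s'}` is `ε(s) ε(t)`
times that of `{s}` in `e_t`. This rests on `C_{t'} = R_t` and `R_{t'} = C_t`. No division by group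
orders occurs, so the characteristic plays no role. -/

namespace Representation

/-- Two representations of `G` spanned by families indexed by the same `G`-set, compatibly with
the action, are equivalent as soon as the two families satisfy the same linear relations. -/
theorem nonempty_equiv_of_linearCombination_eq_zero_iff {K G X V V' : Type*} [CommRing K] [Group G]
    [MulAction G X] [AddCommGroup V] [Module K V] [AddCommGroup V'] [Module K V']
    {ρ : Representation K G V} {ρ' : Representation K G V'} {a : X → V} {b : X → V'}
    (ha : Submodule.span K (Set.range a) = ⊤) (hb : Submodule.span K (Set.range b) = ⊤)
    (hρ : ∀ g x, ρ g (a x) = a (g • x)) (hρ' : ∀ g x, ρ' g (b x) = b (g • x))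
    (h : ∀ c : X →₀ K, Finsupp.linearCombination K a c = 0 ↔ Finsupp.linearCombination K b c = 0) :
    Nonempty (ρ.Equiv ρ') := by
  have ha' : Function.Surjective (Finsupp.linearCombination K a) := by
    rwa [← LinearMap.range_eq_top, Finsupp.range_linearCombination]
  have hb' : Function.Surjective (Finsupp.linearCombination K b) := by
    rwa [← LinearMap.range_eq_top, Finsupp.range_linearCombination]
  -- Both spaces are the quotient of `X →₀ K` by the same space of relations.
  have hker : LinearMap.ker (Finsupp.linearCombination K a)
      = LinearMap.ker (Finsupp.linearCombination K b) := Submodule.ext h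
  let e : V ≃ₗ[K] V' := (LinearMap.quotKerEquivOfSurjective _ ha').symm ≪≫ₗ
    Submodule.quotEquivOfEq _ _ hker ≪≫ₗ LinearMap.quotKerEquivOfSurjective _ hb'
  have he : ∀ x, e (a x) = b x := by
    intro x
    have h1 : (LinearMap.quotKerEquivOfSurjective _ ha').symm (a x)
        = Submodule.Quotient.mk (Finsupp.single x 1) := by
      rw [LinearEquiv.symm_apply_eq, LinearMap.quotKerEquivOfSurjective_apply_mk]
      simp
    simp only [e, LinearEquiv.trans_apply, h1, Submodule.quotEquivOfEq_mk,
      LinearMap.quotKerEquivOfSurjective_apply_mk]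
    simp
  refine ⟨Representation.Equiv.mk e fun g => LinearMap.ext_on_range ha fun x => ?_⟩
  simp only [LinearMap.comp_apply, LinearEquiv.coe_coe, hρ, he, hρ']

end Representation

namespace Hyperoctahedral

variable {r : ℕ} {l : BiPartition r}

instance (μ : YoungDiagram) : Finite {c : ℕ × ℕ // c ∈ μ} :=
  inferInstanceAs (Finite {c : ℕ × ℕ // c ∈ μ.cells})

theorem BiPartition.card_box (l : BiPartition r) : Nat.card l.Box = r := by
  have h : ∀ μ : YoungDiagram, Nat.card {c : ℕ × ℕ // c ∈ μ} = μ.card := fun μ =>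
    (Nat.card_eq_fintype_card (α := {c : ℕ × ℕ // c ∈ μ.cells})).trans (Fintype.card_coe _)
  rw [Nat.card_sum, h, h, l.card_add_card]

/-- The boxes of the transpose of a Young diagram correspond to those of the diagram. -/
def transposeBox (μ : YoungDiagram) : {c : ℕ × ℕ // c ∈ μ.transpose} ≃ {c : ℕ × ℕ // c ∈ μ} :=
  (Equiv.prodComm ℕ ℕ).subtypeEquiv fun _ => YoungDiagram.mem_transpose

/-- The boxes of `l'` correspond to those of `l`. -/
def BiPartition.conjBox (l : BiPartition r) : l.conj.Box ≃ l.Box :=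
  ((transposeBox l.snd).sumCongr (transposeBox l.fst)).trans (Equiv.sumComm _ _)

/-! ### Simple transitivity on bi-tableaux, and conjugation. -/

namespace BiTableau

theorem nonempty (l : BiPartition r) : Nonempty (BiTableau l) := by
  let e : l.Box ≃ Fin r := Finite.equivFinOfCardEq l.card_box
  exact ⟨⟨fun b => (e b, 1), e.bijective⟩⟩

/-- A bi-tableau identifies signed boxes with `{-r, …, -1, 1, …, r}`. -/
noncomputable def signedEquiv (t : BiTableau l) : l.Box × ℤˣ ≃ Pt r :=
  Equiv.ofBijective (fun p => ((t.entry p.1).1, p.2 * (t.entry p.1).2)) <| by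
    constructor
    · rintro ⟨b, ε⟩ ⟨b', ε'⟩ h
      obtain ⟨h1, h2⟩ := Prod.mk.inj h
      obtain rfl : b = b' := t.bijective.1 h1
      simpa using h2
    · rintro ⟨i, ε⟩
      obtain ⟨b, rfl⟩ := t.bijective.2 i
      exact ⟨(b, ε * (t.entry b).2), by simp [mul_assoc, ← sq]⟩

theorem signedEquiv_apply (t : BiTableau l) (b : l.Box) (ε : ℤˣ) :
    t.signedEquiv (b, ε) = ((t.entry b).1, ε * (t.entry b).2) := rfl

theorem signedEquiv_one (t : BiTableau l) (b : l.Box) : t.signedEquiv (b, 1) = t.entry b := by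
  simp [signedEquiv_apply]

theorem signedEquiv_neg (t : BiTableau l) (b : l.Box) (ε : ℤˣ) :
    t.signedEquiv (b, -ε) = negPt (t.signedEquiv (b, ε)) := by
  simp [signedEquiv_apply, negPt]

/-- Passing through signed boxes gives the permutation `t' ∘ t⁻¹`, which commutes with negation. -/
theorem exists_smul_eq (t t' : BiTableau l) : ∃ σ : W r, σ • t = t' := by
  refine ⟨⟨t.signedEquiv.symm.trans t'.signedEquiv, fun x => ?_⟩, ?_⟩
  · obtain ⟨⟨b, ε⟩, rfl⟩ := t.signedEquiv.surjective x
    change t'.signedEquiv (t.signedEquiv.symm _) = negPt (t'.signedEquiv (t.signedEquiv.symm _))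
    rw [← signedEquiv_neg, Equiv.symm_apply_apply, Equiv.symm_apply_apply, signedEquiv_neg]
  · ext1
    funext b
    change t'.signedEquiv (t.signedEquiv.symm (t.entry b)) = _
    rw [← signedEquiv_one, Equiv.symm_apply_apply, signedEquiv_one]

theorem signedEquiv_smul (σ : W r) (t : BiTableau l) (p : l.Box × ℤˣ) :
    (σ • t).signedEquiv p = σ • t.signedEquiv p := by
  obtain ⟨b, ε⟩ := p
  rcases Int.units_eq_one_or ε with rfl | rfl
  · simp only [signedEquiv_one, smul_entry]
  · simp only [signedEquiv_neg, signedEquiv_one, smul_entry, W.smul_negPt]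

theorem smul_left_injective (t : BiTableau l) : Function.Injective fun σ : W r => σ • t := by
  intro σ τ h
  ext1
  refine Equiv.ext fun x => ?_
  obtain ⟨p, rfl⟩ := t.signedEquiv.surjective x
  change σ • t.signedEquiv p = τ • t.signedEquiv p
  rw [← signedEquiv_smul, ← signedEquiv_smul]
  exact congrArg (fun t => t.signedEquiv p) h

/-- By simple transitivity, `ε(t)` can be the sign of the unique element carrying a fixed `t₀` to
`t`. -/
theorem exists_sign (l : BiPartition r) :
    ∃ ε : BiTableau l → ℤˣ, ∀ (σ : W r) t, ε (σ • t) = W.sgn σ * ε t := by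
  obtain ⟨t₀⟩ := nonempty l
  choose g hg using exists_smul_eq t₀
  refine ⟨fun t => W.sgn (g t), fun σ t => ?_⟩
  have h : g (σ • t) = σ * g t := smul_left_injective t₀ (by simp only [hg, mul_smul])
  simp only [h, map_mul]

instance (l : BiPartition r) : Finite (BiTableau l) := by
  exact Finite.of_injective BiTableau.entry fun _ _ => BiTableau.ext

/-- The conjugate bi-tableau: both components are transposed and then exchanged. -/
def conj (t : BiTableau l) : BiTableau l.conj where
  entry b := t.entry (l.conjBox b)
  bijective := t.bijective.comp l.conjBox.bijective

theorem conj_smul (σ : W r) (t : BiTableau l) : (σ • t).conj = σ • t.conj := rfl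

theorem conj_surjective : Function.Surjective (conj (l := l)) := fun t =>
  ⟨⟨fun b => t.entry (l.conjBox.symm b), t.bijective.comp l.conjBox.symm.bijective⟩, by
    ext1; funext b; simp [conj]⟩

theorem row₁_conj (t : BiTableau l) (i : ℕ) : t.conj.row₁ i = t.col₂ i := by
  ext x
  exact (transposeBox l.snd).exists_congr fun _ => Iff.rfl

theorem row₂_conj (t : BiTableau l) (i : ℕ) : t.conj.row₂ i = t.col₁ i := by
  ext x
  exact (transposeBox l.fst).exists_congr fun _ => Iff.rfl

theorem col₁_conj (t : BiTableau l) (i : ℕ) : t.conj.col₁ i = t.row₂ i := by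
  ext x
  exact (transposeBox l.snd).exists_congr fun _ => Iff.rfl

theorem col₂_conj (t : BiTableau l) (i : ℕ) : t.conj.col₂ i = t.row₁ i := by
  ext x
  exact (transposeBox l.fst).exists_congr fun _ => Iff.rfl

/-- Transposing turns columns into rows; exchanging the components moves `t¹`, where `C_t` allows
sign changes, to the second place, where row groups allow them. -/
theorem mem_rowGroup_conj {t : BiTableau l} {σ : W r} :
    σ ∈ t.conj.rowGroup ↔ σ ∈ t.colGroup := by
  simp only [mem_rowGroup, mem_colGroup, row₁_conj, row₂_conj, and_comm]

theorem mem_colGroup_conj {t : BiTableau l} {σ : W r} :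
    σ ∈ t.conj.colGroup ↔ σ ∈ t.rowGroup := by
  simp only [mem_rowGroup, mem_colGroup, col₁_conj, col₂_conj, and_comm]

theorem equiv_smul_iff {t : BiTableau l} {σ : W r} : t ≈ σ • t ↔ σ ∈ t.rowGroup := by
  rw [equiv_iff]
  constructor
  · rintro ⟨τ, hτ, h⟩
    rwa [smul_left_injective t h]
  · exact fun h => ⟨σ, h, rfl⟩

end BiTableau

/-! ### Coordinate forms on the permutation module. -/

variable (K : Type*) [Field K]

/-- The coordinate at the bi-tabloid `{t}`, as a linear form on `M(l)`. -/
noncomputable def tabloidCoord (t : BiTableau l) : Module.Dual K (MonoidAlgebra K (BiTabloid l)) :=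
  Finsupp.lapply (Quotient.mk _ t) ∘ₗ (MonoidAlgebra.coeffLinearEquiv K).toLinearMap

open scoped Classical in
theorem tabloidCoord_tabloid (s t : BiTableau l) :
    tabloidCoord K s (tabloid K t) = if s ≈ t then 1 else 0 := by
  change (Finsupp.single (Quotient.mk _ t) (1 : K)) (Quotient.mk _ s) = _
  rw [Finsupp.single_apply]
  simp only [Quotient.eq]
  exact if_congr ⟨Setoid.symm, Setoid.symm⟩ rfl rfl

theorem eq_zero_of_tabloidCoord_eq_zero {v : MonoidAlgebra K (BiTabloid l)}
    (h : ∀ t, tabloidCoord K t v = 0) : v = 0 := by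
  refine MonoidAlgebra.coeff_injective (Finsupp.ext fun T => ?_)
  obtain ⟨t, rfl⟩ := Quotient.exists_rep T
  exact h t

theorem linearMap_ext_tabloid {V : Type*} [AddCommGroup V] [Module K V]
    {f g : MonoidAlgebra K (BiTabloid l) →ₗ[K] V} (h : ∀ t, f (tabloid K t) = g (tabloid K t)) :
    f = g := by
  refine MonoidAlgebra.lhom_ext' fun T => LinearMap.ext_ring ?_
  obtain ⟨t, rfl⟩ := Quotient.exists_rep T
  exact h t

theorem tabloidCoord_permModule (σ : W r) (t : BiTableau l) (v : MonoidAlgebra K (BiTabloid l)) :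
    tabloidCoord K t (permModule K l σ⁻¹ v) = tabloidCoord K (σ • t) v := by
  classical
  suffices h : tabloidCoord K t ∘ₗ permModule K l σ⁻¹ = tabloidCoord K (σ • t) from
    LinearMap.congr_fun h v
  refine linearMap_ext_tabloid K fun s => ?_
  simp only [LinearMap.comp_apply, permModule_tabloid, tabloidCoord_tabloid]
  refine if_congr ⟨fun h => ?_, fun h => ?_⟩ rfl rfl
  · simpa using BiTableau.smul_equiv_smul σ h
  · simpa using BiTableau.smul_equiv_smul σ⁻¹ h

theorem span_tabloidCoord :
    Submodule.span K (Set.range (tabloidCoord K (l := l))) = ⊤ := by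
  classical
  have := Fintype.ofFinite (BiTabloid l)
  refine eq_top_iff.2 fun φ _ => ?_
  -- Expansion of `φ` in the dual basis of the finite basis of bi-tabloids.
  have h : φ = ∑ T : BiTabloid l, φ (tabloid K T.out) • tabloidCoord K T.out := by
    refine linearMap_ext_tabloid K fun t => ?_
    have h' : ∀ T : BiTabloid l, T.out ≈ t ↔ T = Quotient.mk _ t := fun T => by
      rw [← Quotient.eq_iff_equiv, Quotient.out_eq]
    simp only [LinearMap.sum_apply, LinearMap.smul_apply, tabloidCoord_tabloid, h', smul_eq_mul,
      mul_ite, mul_one, mul_zero, Finset.sum_ite_eq', Finset.mem_univ, if_true]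
    simp only [tabloid, Quotient.out_eq]
  rw [h]
  exact Submodule.sum_mem _ fun T _ => Submodule.smul_mem _ _ (Submodule.subset_span ⟨_, rfl⟩)

open scoped Classical in
theorem tabloidCoord_polytabloid (s t : BiTableau l) :
    tabloidCoord K s (polytabloid K t) =
      ∑ σ : W r, if σ ∈ t.colGroup ∧ s ≈ σ • t then (((W.sgn σ : ℤˣ) : ℤ) : K) else 0 := by
  simp only [polytabloid_eq, map_sum, map_smul, tabloidCoord_tabloid, smul_eq_mul, mul_ite, mul_one,
    mul_zero]
  simp only [ite_and]
  refine Eq.trans ?_ (Finset.sum_filter (· ∈ t.colGroup)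
    fun σ : W r => if s ≈ σ • t then (((W.sgn σ : ℤˣ) : ℤ) : K) else 0)
  exact (Finset.sum_subtype (p := (· ∈ t.colGroup)) _ (fun σ => Finset.mem_filter_univ σ)
    fun σ : W r => if s ≈ σ • t then (((W.sgn σ : ℤˣ) : ℤ) : K) else 0).symm

/-- The coordinates of the polytabloids of shapes `l'` and `l` agree up to sign. -/
theorem tabloidCoord_conj_polytabloid (σ : W r) (t : BiTableau l) :
    tabloidCoord K t.conj (polytabloid K (σ • t).conj) =
      (((W.sgn σ : ℤˣ) : ℤ) : K) * tabloidCoord K (σ • t) (polytabloid K t) := by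
  classical
  rw [tabloidCoord_polytabloid, tabloidCoord_polytabloid, Finset.mul_sum]
  -- Under `τ ↦ τσ` both sums run over the `τ` in `R_{σt}` with `τσ` in `C_t`, and `sgn(σ) sgn(τσ) =
  -- sgn(τ)`.
  refine Fintype.sum_equiv (Equiv.mulRight σ) _ _ fun τ => ?_
  have h1 : t.conj ≈ τ • (σ • t).conj ↔ τ * σ ∈ t.colGroup := by
    rw [BiTableau.conj_smul, smul_smul, BiTableau.equiv_smul_iff, BiTableau.mem_rowGroup_conj]
  have h2 : σ • t ≈ (τ * σ) • t ↔ τ ∈ (σ • t).rowGroup := by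
    rw [mul_smul, BiTableau.equiv_smul_iff]
  simp only [h1, h2, BiTableau.mem_colGroup_conj, Equiv.coe_mulRight, mul_ite, mul_zero, and_comm]
  refine if_congr Iff.rfl ?_ rfl
  rw [map_mul, mul_comm (W.sgn τ), Units.val_mul, Int.cast_mul, ← mul_assoc, ← Int.cast_mul,
    ← Units.val_mul]
  simp

/-! ### Spanning families of the Specht module and its dual. -/

/-- The polytabloid `e_t` as an element of the Specht module. -/
noncomputable def spechtPolytabloid (t : BiTableau l) : (spechtSub K l).toSubmodule :=
  ⟨polytabloid K t, Submodule.subset_span ⟨t, rfl⟩⟩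

theorem specht_spechtPolytabloid (σ : W r) (t : BiTableau l) :
    specht K l σ (spechtPolytabloid K t) = spechtPolytabloid K (σ • t) :=
  Subtype.ext (permModule_polytabloid K σ t)

theorem span_spechtPolytabloid :
    Submodule.span K (Set.range (spechtPolytabloid K (l := l))) = ⊤ := by
  refine Submodule.map_injective_of_injective (spechtSub K l).toSubmodule.injective_subtype ?_
  rw [Submodule.map_span, ← Set.range_comp, Submodule.map_subtype_top]
  rfl

/-- The coordinate at the bi-tabloid `{t}`, as a linear form on the Specht module. -/
noncomputable def spechtCoord (t : BiTableau l) : Module.Dual K (spechtSub K l).toSubmodule :=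
  tabloidCoord K t ∘ₗ (spechtSub K l).toSubmodule.subtype

theorem dualSpecht_spechtCoord (σ : W r) (t : BiTableau l) :
    dualSpecht K l σ (spechtCoord K t) = spechtCoord K (σ • t) :=
  LinearMap.ext fun v => tabloidCoord_permModule K σ t v

theorem span_spechtCoord : Submodule.span K (Set.range (spechtCoord K (l := l))) = ⊤ := by
  -- Over a field every form on the subspace `S(λ)` extends to `M(λ)`.
  have h : Function.Surjective (LinearMap.lcomp K K (spechtSub K l).toSubmodule.subtype) := fun φ =>
    LinearMap.exists_extend φ
  have h' := Submodule.map_top (LinearMap.lcomp K K (spechtSub K l).toSubmodule.subtype)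
  rw [LinearMap.range_eq_top.2 h, ← span_tabloidCoord, Submodule.map_span, ← Set.range_comp] at h'
  exact h'

/-! ### The sign module is one-dimensional. -/

theorem BiTableau.colGroup_signShape (t : BiTableau (signShape r)) : t.colGroup = ⊤ := by
  have hc : ∀ c ∈ (signShape r).fst, c.2 = 0 := fun c hc => by
    have : c ∈ Finset.range r ×ˢ ({0} : Finset ℕ) := hc
    simpa using (Finset.mem_product.1 this).2
  have h0 : ∀ c, c ∉ (signShape r).snd := fun c => YoungDiagram.notMem_bot c
  have h₂ : ∀ j, t.col₂ j = ∅ := fun j => Set.eq_empty_of_forall_notMem fun x => by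
    rintro ⟨c, -⟩
    exact h0 _ c.2
  have h₁ : ∀ j, j ≠ 0 → t.col₁ j = ∅ := fun j hj => Set.eq_empty_of_forall_notMem fun x => by
    rintro ⟨c, hcj, -⟩
    exact hj (hcj ▸ hc _ c.2)
  have h₁' : t.col₁ 0 = Set.univ := Set.eq_univ_of_forall fun x => by
    obtain ⟨⟨c | c, ε⟩, rfl⟩ := t.signedEquiv.surjective x
    · refine ⟨c, hc _ c.2, ?_⟩
      rcases Int.units_eq_one_or ε with rfl | rfl
      · exact Or.inl (signedEquiv_one _ _)
      · exact Or.inr (by rw [signedEquiv_neg, signedEquiv_one])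
    · exact (h0 _ c.2).elim
  refine eq_top_iff.2 fun σ _ => mem_colGroup.2 ⟨fun j => ?_, fun j => by simp [h₂]⟩
  rcases eq_or_ne j 0 with rfl | hj
  · rw [h₁', Set.smul_set_univ]
  · simp [h₁ j hj]

theorem BiTableau.rowGroup_signShape (t : BiTableau (signShape r)) : t.rowGroup = ⊥ := by
  refine eq_bot_iff.2 fun σ hσ => ?_
  have hc : ∀ c ∈ (signShape r).fst, c.2 = 0 := fun c hc => by
    have : c ∈ Finset.range r ×ˢ ({0} : Finset ℕ) := hc
    simpa using (Finset.mem_product.1 this).2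
  refine t.smul_left_injective (BiTableau.ext (funext fun b => ?_))
  change σ • t.entry b = (1 : W r) • t.entry b
  rw [one_smul]
  obtain c | c := b
  · have h : σ • t.entry (.inl c) ∈ t.row₁ c.1.1 := by
      rw [← (mem_rowGroup.1 hσ).1]
      exact Set.smul_mem_smul_set ⟨c, rfl, rfl⟩
    obtain ⟨d, hd, h⟩ := h
    rw [h, show d = c from Subtype.ext (Prod.ext hd (by rw [hc _ c.2, hc _ d.2]))]
  · exact (YoungDiagram.notMem_bot _ c.2).elim

theorem polytabloid_smul_of_mem_colGroup {t : BiTableau l} {σ : W r} (hσ : σ ∈ t.colGroup) :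
    polytabloid K (σ • t) = (((W.sgn σ : ℤˣ) : ℤ) : K) • polytabloid K t := by
  classical
  rw [← permModule_polytabloid, polytabloid_eq, Finset.smul_sum, map_sum]
  refine Fintype.sum_equiv (Equiv.mulLeft ⟨σ, hσ⟩) _ _ fun τ => ?_
  rw [map_smul, permModule_tabloid, smul_smul, smul_smul, ← Int.cast_mul, ← Units.val_mul]
  simp [← mul_assoc]

/-- With trivial row group only `σ = 1` contributes to this coefficient, so `e_t` is nonzero in
every characteristic. -/
theorem polytabloid_signShape_coord (t : BiTableau (signShape r)) :
    tabloidCoord K t (polytabloid K t) = 1 := by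
  classical
  rw [tabloidCoord_polytabloid]
  simp [BiTableau.equiv_smul_iff, BiTableau.rowGroup_signShape, BiTableau.colGroup_signShape]

theorem spechtPolytabloid_smul_signShape (σ : W r) (t : BiTableau (signShape r)) :
    spechtPolytabloid K (σ • t) = (((W.sgn σ : ℤˣ) : ℤ) : K) • spechtPolytabloid K t :=
  Subtype.ext (polytabloid_smul_of_mem_colGroup K (by simp [BiTableau.colGroup_signShape]))

theorem span_spechtPolytabloid_signShape (t : BiTableau (signShape r)) :
    Submodule.span K {spechtPolytabloid K t} = ⊤ := by
  rw [eq_top_iff, ← span_spechtPolytabloid, Submodule.span_le]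
  rintro _ ⟨s, rfl⟩
  obtain ⟨σ, rfl⟩ := t.exists_smul_eq s
  rw [spechtPolytabloid_smul_signShape]
  exact Submodule.smul_mem _ _ (Submodule.mem_span_singleton_self _)

/-! ### Comparison of the linear relations. -/

open scoped TensorProduct

theorem tmul_spechtPolytabloid_signShape_eq_zero {V : Type*} [AddCommGroup V] [Module K V]
    (t : BiTableau (signShape r)) {v : V} : v ⊗ₜ[K] spechtPolytabloid K t = 0 ↔ v = 0 := by
  refine ⟨fun h => ?_, fun h => by rw [h, TensorProduct.zero_tmul]⟩
  -- Contracting with a form that takes the value `1` on `e_t` recovers `v`.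
  have h' := congrArg (TensorProduct.rid K V ∘ LinearMap.lTensor V (spechtCoord K t)) h
  simpa [show spechtCoord K t (spechtPolytabloid K t) = 1 from
    polytabloid_signShape_coord K t] using h'

theorem specht_relations_iff {ε : BiTableau l → ℤˣ}
    (hε : ∀ (σ : W r) t, ε (σ • t) = W.sgn σ * ε t) (c : BiTableau l →₀ K) :
    Finsupp.linearCombination K (fun t => spechtCoord K t.conj) c = 0 ↔
      Finsupp.linearCombination K
        (fun t => (((ε t : ℤˣ) : ℤ) : K) • spechtPolytabloid K t) c = 0 := by
  have key : ∀ s t : BiTableau l, spechtCoord K t.conj (spechtPolytabloid K s.conj)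
      = (((ε s : ℤˣ) : ℤ) : K) *
        tabloidCoord K s ((((ε t : ℤˣ) : ℤ) : K) • polytabloid K t) := by
    intro s t
    obtain ⟨σ, rfl⟩ := t.exists_smul_eq s
    refine (tabloidCoord_conj_polytabloid K σ t).trans ?_
    rw [hε, map_smul, smul_eq_mul, ← mul_assoc, ← Int.cast_mul, ← Units.val_mul, mul_assoc,
      Int.units_mul_self, mul_one]
  have hunit : ∀ s : BiTableau l, (((ε s : ℤˣ) : ℤ) : K) ≠ 0 := fun s => by
    rcases Int.units_eq_one_or (ε s) with h | h <;> simp [h]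
  have h : ∀ s : BiTableau l,
      Finsupp.linearCombination K (fun t => spechtCoord K t.conj) c (spechtPolytabloid K s.conj)
      = (((ε s : ℤˣ) : ℤ) : K) * tabloidCoord K s (Finsupp.linearCombination K
        (fun t => (((ε t : ℤˣ) : ℤ) : K) • spechtPolytabloid K t) c : (spechtSub K l).toSubmodule) := by
    intro s
    simp only [Finsupp.linearCombination_apply, Finsupp.sum, LinearMap.sum_apply,
      LinearMap.smul_apply, key, Submodule.coe_sum, Submodule.coe_smul, map_sum, map_smul,
      Finset.mul_sum, smul_eq_mul]
    refine Finset.sum_congr rfl fun t _ => ?_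
    simp only [spechtPolytabloid]
    ring
  constructor
  · intro h0
    refine Subtype.ext (eq_zero_of_tabloidCoord_eq_zero K fun s => ?_)
    have := h s
    rw [h0, LinearMap.zero_apply] at this
    exact (mul_eq_zero.1 this.symm).resolve_left (hunit s)
  · intro h0
    refine LinearMap.ext_on_range (span_spechtPolytabloid K) fun s' => ?_
    -- Every polytabloid of shape `λ'` is some `e_{s'}`, so testing on these suffices.
    obtain ⟨s, rfl⟩ := BiTableau.conj_surjective s'
    rw [h s, h0]
    simp

end Hyperoctahedral

open scoped TensorProduct in
theorem mainTheorem12 (K : Type*) [Field K] (r : ℕ) (l : Hyperoctahedral.BiPartition r) :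
    Nonempty (Representation.Equiv
      (Hyperoctahedral.dualSpecht K l.conj)
      ((Hyperoctahedral.specht K l).tprod
        (Hyperoctahedral.specht K (Hyperoctahedral.signShape r)))) := by
  open Hyperoctahedral in
  obtain ⟨ε, hε⟩ := BiTableau.exists_sign l
  obtain ⟨u⟩ := BiTableau.nonempty (signShape r)
  have hε' : ∀ t, (((ε t : ℤˣ) : ℤ) : K) * (((ε t : ℤˣ) : ℤ) : K) = 1 := fun t => by
    rw [← Int.cast_mul, ← Units.val_mul, Int.units_mul_self, Units.val_one, Int.cast_one]
  refine Representation.nonempty_equiv_of_linearCombination_eq_zero_iff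
    (a := fun t : BiTableau l => spechtCoord K t.conj)
    (b := fun t => ((((ε t : ℤˣ) : ℤ) : K) • spechtPolytabloid K t) ⊗ₜ[K] spechtPolytabloid K u)
    ?_ ?_ (fun σ t => dualSpecht_spechtCoord K σ t.conj) (fun σ t => ?_) fun c => ?_
  · rw [← span_spechtCoord K (l := l.conj), ← BiTableau.conj_surjective.range_comp]
    rfl
  · rw [eq_top_iff, ← TensorProduct.map₂_mk_top_top_eq_top, ← span_spechtPolytabloid,
      ← span_spechtPolytabloid_signShape K u, Submodule.map₂_span_span, Submodule.span_le]
    rintro _ ⟨_, ⟨t, rfl⟩, _, rfl, rfl⟩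
    -- Scaling by `ε(t)` again removes the sign, since `ε(t)² = 1`.
    have h := Submodule.smul_mem _ (((ε t : ℤˣ) : ℤ) : K)
      (Submodule.subset_span (R := K) (Set.mem_range_self (f := fun t =>
        ((((ε t : ℤˣ) : ℤ) : K) • spechtPolytabloid K t) ⊗ₜ[K] spechtPolytabloid K u) t))
    rwa [TensorProduct.smul_tmul', smul_smul, hε', one_smul] at h
  -- The factor `sgn(σ)` coming from `e_u` is what turns `ε(t)` into `ε(σt)`.
  · rw [Representation.tprod_apply, TensorProduct.map_tmul, map_smul, specht_spechtPolytabloid,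
      specht_spechtPolytabloid, spechtPolytabloid_smul_signShape, hε, TensorProduct.tmul_smul,
      TensorProduct.smul_tmul', smul_smul, ← Int.cast_mul, ← Units.val_mul]
  · rw [specht_relations_iff K hε, ← tmul_spechtPolytabloid_signShape_eq_zero K u]
    simp only [Finsupp.linearCombination_apply, Finsupp.sum, TensorProduct.sum_tmul,
      TensorProduct.smul_tmul']
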